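/- **Setting.** Let $d\ge 1$, let $\mathcal X\subseteq\mathbb R^d$ with the Euclidean norm, and let $f$ be a probability density on $\mathbb R^d$ (with respect to Lebesgue measure) that vanishes outside $\mathcal X$. Let $B(x,r)$ be the closed ball of radius $r$ around $x$ and $v_d$ the volume of the unit ball. For $Z\subseteq\mathbb R^d$ and $\sigma>0$ let $Z_\sigma=\{y:\inf_{z\in Z}\|y-z\|\le\sigma\}$. Connected means path-connected (and non-empty). *Separation.* Sets $A,A'\subseteq\mathcal X$ are $(\sigma,\epsilon)$-separated if there is $S\subseteq\mathcal X$ such that (i) every path in $\mathcal X$ from a point of $A$ to a point of $A'$ meets $S$, and (ii) $\sup_{S_\sigma} f<(1-\epsilon)\inf_{A_\sigma\cup A'_\sigma} f$ (the supremum over the empty set being $0$). Say that $\mathcal X$ has no gaps at scale $\sigma$ if any $x,y\in\mathcal X$ with $\|x-y\|\le\sigma$ can be joined by a path in $\mathcal X\cap(B(x,\sigma/2)\cup B(y,\sigma/2))$; this holds for every $\sigma$ if $\mathcal X$ is convex, in particular if $\mathcal X=\mathbb R^d$. *Algorithm (robust single linkage).* Given $X_n=\{x_1,\dots,x_n\}$,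 an integer $k\ge1$ and $\alpha$, let $r_k(x_i)$ be the least $r$ such that $B(x_i,r)$ contains at least $k$ data points. For $r\ge 0$, the graph $G_r$ has the nodes $\{x_i: r_k(x_i)\le r\}$ and an edge between any two distinct nodes with $\|x_i-x_j\|\le\alpha r$. **Theorem.** There are absolute constants $C,C_0>0$ such that the following holds for all $d$, $\mathcal X$, $f$ as above. Let $0<\delta,\epsilon<1$, let $X_n$ consist of $n$ independent draws from $f$, and let $$\sqrt2\le\alpha\le2,\qquad k\ \ge\ C\cdot\frac{d\log n}{\epsilon^2}\cdot\log^2\frac2\delta .$$ Then there is a mapping $r:[0,\infty)\to[0,\infty)$, given for $\lambda>0$ by $$v_d\,r(\lambda)^d\,\lambda=\frac kn+\frac{C_\delta}{n}\sqrt{k\,d\log n},\qquad C_\delta=C_0\log\frac2\delta ,$$ such that with probability at least $1-\delta$ the following holds simultaneously for all connected $A,A'\subseteq\mathcal X$ and all $\sigma>0$ such that $\mathcal X$ has no gaps at scale $\sigma$ and $A,A'$ are $(\sigma,\epsilon)$-separated. Let $\lambda=\inf_{A_\sigma\cup A'_\sigma}f$. If $$n\ \ge\ \frac{k}{v_d(\sigma/2)^d\lambda}\Bigl(1+\frac\epsilon2\Bigr),$$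 then: 1. *Separation.* $A\cap X_n$ is disconnected from $A'\cap X_n$ in $G_{r(\lambda)}$, that is, no path of the graph leads from a point of the one to a point of the other. 2. *Connectedness.* $A\cap X_n$ and $A'\cap X_n$ are each connected in $G_{r(\lambda)}$, that is, all points of $A\cap X_n$ are nodes of $G_{r(\lambda)}$ and lie in one connected component, and likewise for $A'\cap X_n$. -/

import Mathlib

open MeasureTheory
open scoped ENNReal

noncomputable section

namespace ClusterTree

/-- `d`-dimensional Euclidean space. -/
abbrev E (d : ℕ) : Type := EuclideanSpace ℝ (Fin d)

/-- The volume `v_d` of the unit ball of `ℝ^d`. -/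
def unitBallVol (d : ℕ) : ℝ := (volume (Metric.closedBall (0 : E d) 1)).toReal

/-- `f` is a probability density on `ℝ^d` (with respect to Lebesgue measure) that vanishes
outside `𝒳`. -/
structure IsDensityOn {d : ℕ} (f : E d → ℝ) (𝒳 : Set (E d)) : Prop where
  measurable : Measurable f
  nonneg : ∀ x, 0 ≤ f x
  zero_outside : ∀ x, x ∉ 𝒳 → f x = 0
  lintegral_eq_one : ∫⁻ x, ENNReal.ofReal (f x) = 1

/-- The law of a sample `x₁, …, xₙ` of `n` independent draws from the density `f`. -/
def sampleLaw {d : ℕ} (f : E d → ℝ) (n : ℕ) : Measure (Fin n → E d) :=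
  Measure.pi fun _ => volume.withDensity fun x => ENNReal.ofReal (f x)

/-! ### Robust single linkage -/

/-- `r_k(x_i)`, the least radius `r` such that the closed ball `B(x_i, r)` contains at least `k`
of the `n` data points (`x_i` itself included); `∞` if there is none, that is, if `k > n`. -/
def kRadius {d n : ℕ} (x : Fin n → E d) (k : ℕ) (i : Fin n) : ℝ≥0∞ :=
  sInf {ρ : ℝ≥0∞ | k ≤ Set.ncard {j : Fin n | edist (x j) (x i) ≤ ρ}}

/-- The nodes of `G_r`: the data points with `r_k(x_i) ≤ r`. -/
def nodes {d n : ℕ} (x : Fin n → E d) (k : ℕ) (r : ℝ) : Set (Fin n) :=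
  {i | kRadius x k i ≤ ENNReal.ofReal r}

/-- The graph `G_r`: two distinct nodes are adjacent if they are within distance `α r`. -/
def linkGraph {d n : ℕ} (x : Fin n → E d) (k : ℕ) (α r : ℝ) : SimpleGraph (nodes x k r) where
  Adj i j := i ≠ j ∧ dist (x i) (x j) ≤ α * r
  symm := ⟨fun _ _ h => ⟨h.1.symm, by rw [dist_comm]; exact h.2⟩⟩
  loopless := ⟨fun _ h => h.1 rfl⟩

/-- `A ∩ X_n` is connected in `G_r`: all data points in `A` are nodes of `G_r`, and any two of
them lie in the same connected component. -/
def ConnectedInGraph {d n : ℕ} (x : Fin n → E d) (k : ℕ) (α r : ℝ) (A : Set (E d)) : Prop :=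
  (∀ i, x i ∈ A → i ∈ nodes x k r) ∧
    ∀ i j : nodes x k r, x i ∈ A → x j ∈ A → (linkGraph x k α r).Reachable i j

/-- `A ∩ X_n` is disconnected from `A' ∩ X_n` in `G_r`: no path of `G_r` leads from a point of
the former to a point of the latter. -/
def DisconnectedInGraph {d n : ℕ} (x : Fin n → E d) (k : ℕ) (α r : ℝ) (A A' : Set (E d)) :
    Prop :=
  ∀ i j : nodes x k r, x i ∈ A → x j ∈ A' → ¬ (linkGraph x k α r).Reachable i j

/-! ### Separation -/

/-- The infimum of `f` over `A_σ ∪ A'_σ`, where `Z_σ` is the set of points at distance at most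
`σ` from `Z`. -/
def level {d : ℕ} (f : E d → ℝ) (σ : ℝ) (A A' : Set (E d)) : ℝ :=
  sInf (f '' (Metric.cthickening σ A ∪ Metric.cthickening σ A'))

/-- `A` and `A'` are `(σ, ε)`-separated (for the density `f` on `𝒳`). Boundedness of `f` on `S_σ`
says that the supremum is finite; over the empty set the supremum is `0`. -/
def Separated {d : ℕ} (f : E d → ℝ) (𝒳 : Set (E d)) (σ ε : ℝ) (A A' : Set (E d)) : Prop :=
  ∃ S : Set (E d), S ⊆ 𝒳 ∧
    (∀ a ∈ A, ∀ a' ∈ A', ∀ γ : Path a a', (∀ t, γ t ∈ 𝒳) → ∃ t, γ t ∈ S) ∧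
    BddAbove (f '' Metric.cthickening σ S) ∧
    sSup (f '' Metric.cthickening σ S) < (1 - ε) * level f σ A A'

/-- `𝒳` has no gaps at scale `σ`: points of `𝒳` within distance `σ` of each other are joined by
a path in `𝒳` all of whose points are within `σ / 2` of one of the two. Every convex set has this
property for every `σ`. -/
def NoGaps {d : ℕ} (𝒳 : Set (E d)) (σ : ℝ) : Prop :=
  ∀ x ∈ 𝒳, ∀ y ∈ 𝒳, dist x y ≤ σ →
    JoinedIn (𝒳 ∩ (Metric.closedBall x (σ / 2) ∪ Metric.closedBall y (σ / 2))) x y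

end ClusterTree

end

/-! Put `s = C_δ √(k d log n)` and `r = r(λ)`. A ball of radius `r` on which `f ≥ λ` has mass at
least `(k + s)/n`. One on which `f < (1 - ε)λ` has mass at most `(1 - ε)(k + s)/n ≤ (k - s)/n`,
since the bound on `k` gives `s ≤ εk/2`. The sample-size condition gives `r ≤ σ/2`. Hence everything
follows if balls around data points of mass at least `(k + s)/n` hold at least `k` data points,
those of mass at most `(k - s)/n` hold fewer, and certain half-balls are matched by data points.

Separation (`disconnectedInGraph_of_sample`): a data point within `σ/2` of `S` has its `r`-ball
inside `S_σ`, so it is not a node. Edges have length at most `2r ≤ σ`, and the no-gaps condition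
turns a graph path into a path in `𝒳` that avoids `S`. Connectedness (`connectedInGraph_of_sample`):
follow a path in `A`. Where it is about to leave the `r`-balls around the current component, the
half-ball facing the last node supplies a new node within `√2 r`, and the component reaches further.

Probability: given its centre, a family of balls is nested, so one Chernoff bound at a quantile
covers all radii (`exists_uniform_lower`, `exists_uniform_upper`), and a union bound over the
centres suffices. Half-balls are not nested. They are replaced by regions (`regionGauge`) that grow
with `r` and depend on a direction from a finite grid; the union over the grid costs a term of order
`d log n`, which `k` absorbs. -/

noncomputable section

namespace ClusterTree

/-! ### Quantiles -/

section Quantile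

/-- The values whose closed lower tail has mass at most `p` have total mass at most `p`. -/
lemma measure_setOf_measure_Iic_le (ν : Measure ℝ) [IsFiniteMeasure ν] (p : ℝ≥0∞) :
    ν {t | ν (Set.Iic t) ≤ p} ≤ p := by
  have hmeas : MeasurableSet {t | ν (Set.Iic t) ≤ p} := by
    refine Set.OrdConnected.measurableSet (IsLowerSet.ordConnected ?_)
    intro a b hba ha
    exact (measure_mono (Set.Iic_subset_Iic.2 hba)).trans ha
  -- The set need not have a maximum; a compact subset does, and lies in the closed tail of its
  -- maximum. Inner regularity then suffices.
  rw [hmeas.measure_eq_iSup_isCompact]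
  refine iSup_le fun K => iSup_le fun hK => iSup_le fun hc => ?_
  rcases K.eq_empty_or_nonempty with rfl | hne
  · simp
  · obtain ⟨t, ht⟩ := hc.exists_isGreatest hne
    exact (measure_mono fun s hs => ht.2 hs).trans (hK ht.1)

/-- The values whose open lower tail has mass at least `p` have total mass at most `1 - p`. -/
lemma measure_setOf_le_measure_Iio (ν : Measure ℝ) [IsProbabilityMeasure ν] (p : ℝ≥0∞) :
    ν {t | p ≤ ν (Set.Iio t)} ≤ 1 - p := by
  have hmeas : MeasurableSet {t | p ≤ ν (Set.Iio t)} := by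
    refine Set.OrdConnected.measurableSet (IsUpperSet.ordConnected ?_)
    intro a b hba ha
    exact ha.trans (measure_mono (Set.Iio_subset_Iio hba))
  rw [hmeas.measure_eq_iSup_isCompact]
  refine iSup_le fun K => iSup_le fun hK => iSup_le fun hc => ?_
  rcases K.eq_empty_or_nonempty with rfl | hne
  · simp
  · obtain ⟨t, ht⟩ := hc.exists_isLeast hne
    have hK' : K ⊆ (Set.Iio t)ᶜ := fun s hs => by simpa using ht.2 hs
    calc ν K ≤ ν (Set.Iio t)ᶜ := measure_mono hK'
      _ = 1 - ν (Set.Iio t) := prob_compl_eq_one_sub measurableSet_Iio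
      _ ≤ 1 - p := tsub_le_tsub_left (hK ht.1) 1

variable {Ω : Type*} [MeasurableSpace Ω] (μ : Measure Ω) [IsProbabilityMeasure μ]

/-- Push forward along `g`. Closed sublevel sets make this valid in the presence of atoms; the
reverse bound below needs open ones. -/
lemma measure_upper_quantile_le {g : Ω → ℝ} (hg : Measurable g) (p : ℝ≥0∞) :
    μ {z | μ {w | g w ≤ g z} ≤ p} ≤ p := by
  have := Measure.isProbabilityMeasure_map (μ := μ) hg.aemeasurable
  have h := measure_setOf_measure_Iic_le (μ.map g) p
  refine le_trans (le_trans (measure_mono ?_) (Measure.le_map_apply hg.aemeasurable _)) h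
  intro z hz
  simpa [Measure.map_apply hg measurableSet_Iic, Set.preimage] using hz

lemma le_measure_lower_quantile {g : Ω → ℝ} (hg : Measurable g) {p : ℝ≥0∞} (hp : p ≤ 1) :
    p ≤ μ {z | μ {w | g w < g z} < p} := by
  have := Measure.isProbabilityMeasure_map (μ := μ) hg.aemeasurable
  have h := measure_setOf_le_measure_Iio (μ.map g) p
  have h1 : μ {z | p ≤ μ {w | g w < g z}} ≤ 1 - p := by
    refine le_trans (le_trans (measure_mono ?_) (Measure.le_map_apply hg.aemeasurable _)) h
    intro z hz
    simpa [Measure.map_apply hg measurableSet_Iio, Set.preimage] using hz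
  have h2 : (1 : ℝ≥0∞) ≤ μ {z | μ {w | g w < g z} < p} + μ {z | p ≤ μ {w | g w < g z}} := by
    rw [← measure_univ (μ := μ)]
    refine (measure_mono fun z _ => ?_).trans (measure_union_le _ _)
    exact lt_or_ge (μ {w | g w < g z}) p
  have h3 : (1 : ℝ≥0∞) ≤ μ {z | μ {w | g w < g z} < p} + (1 - p) :=
    h2.trans (add_le_add_right h1 _)
  have h4 : (1 : ℝ≥0∞) - (1 - p) ≤ μ {z | μ {w | g w < g z} < p} :=
    tsub_le_iff_right.2 h3
  rwa [ENNReal.sub_sub_cancel ENNReal.one_ne_top hp] at h4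

end Quantile

/-! ### Tail bounds for counts -/

section Tail

lemma ncard_setOf_eq_sum {ι : Type*} [Fintype ι] (P : ι → Prop) [DecidablePred P] :
    (Set.ncard {j | P j} : ℝ) = ∑ j, if P j then (1 : ℝ) else 0 := by
  rw [Finset.sum_boole, Set.ncard_eq_toFinset_card']
  congr 2
  ext; simp

lemma measurable_ncard_setOf {β ι : Type*} [MeasurableSpace β] [Fintype ι] {P : ι → β → Prop}
    (hP : ∀ j, MeasurableSet {y | P j y}) :
    Measurable fun y => (Set.ncard {j | P j y} : ℝ) := by
  classical
  simp_rw [ncard_setOf_eq_sum]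
  exact Finset.measurable_sum _ fun j _ => Measurable.ite (hP j) measurable_const measurable_const

variable {Ω : Type*} [MeasurableSpace Ω] (μ : Measure Ω) [IsProbabilityMeasure μ]

/-- Exponential Markov inequality for the number of sample points in a set. -/
lemma measure_le_mul_ncard_le {S : Set Ω} (hS : MeasurableSet S) (m : ℕ) (θ b : ℝ) :
    (Measure.pi fun _ : Fin m => μ) {z | b ≤ θ * (Set.ncard {j | z j ∈ S} : ℝ)} ≤
      ENNReal.ofReal (Real.exp (-b + m * (μ.real S * (Real.exp θ - 1)))) := by
  classical
  set X : (Fin m → Ω) → ℝ := fun z => θ * (Set.ncard {j | z j ∈ S} : ℝ) with hX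
  set w : Ω → ℝ := fun y => 1 + S.indicator (fun _ => Real.exp θ - 1) y with hw
  -- The exponential of the count is a product of independent factors `1 + 1_S (e^θ - 1)`. The sign
  -- of `θ` is free, so both tails are covered.
  have hprod : ∀ z, Real.exp (X z) = ∏ j, w (z j) := by
    intro z
    simp only [hX, ncard_setOf_eq_sum, Finset.mul_sum, Real.exp_sum]
    refine Finset.prod_congr rfl fun j _ => ?_
    by_cases h : z j ∈ S <;> simp [hw, h]
  have hint : ∫ y, w y ∂μ = 1 + μ.real S * (Real.exp θ - 1) := by
    rw [hw, integral_add (integrable_const _) ((integrable_const _).indicator hS),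
      integral_indicator_const _ hS]
    simp
  have hXm : Measurable X := by
    refine (measurable_ncard_setOf fun j => ?_).const_mul θ
    exact measurable_pi_apply j hS
  have hbound : ∀ z, Real.exp (X z) ≤ Real.exp (|θ| * m) := by
    intro z
    apply Real.exp_le_exp.2
    have h1 : (Set.ncard {j | z j ∈ S} : ℝ) ≤ m := by
      have := Set.ncard_le_card {j | z j ∈ S}
      simp only [Nat.card_eq_fintype_card, Fintype.card_fin] at this
      exact_mod_cast this
    calc X z ≤ |θ| * (Set.ncard {j | z j ∈ S} : ℝ) :=
          mul_le_mul_of_nonneg_right (le_abs_self θ) (by positivity)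
      _ ≤ |θ| * m := mul_le_mul_of_nonneg_left h1 (abs_nonneg θ)
  have hI : Integrable (fun z => Real.exp (X z)) (Measure.pi fun _ : Fin m => μ) := by
    refine Integrable.of_bound (Real.measurable_exp.comp hXm).aestronglyMeasurable
      (Real.exp (|θ| * m)) (Filter.Eventually.of_forall fun z => ?_)
    rw [Real.norm_eq_abs, abs_of_pos (Real.exp_pos _)]
    exact hbound z
  have hmk := mul_meas_ge_le_integral_of_nonneg
    (Filter.Eventually.of_forall fun z => (Real.exp_pos (X z)).le) hI (Real.exp b)
  have hE : ∫ z, Real.exp (X z) ∂(Measure.pi fun _ : Fin m => μ) ≤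
      Real.exp (m * (μ.real S * (Real.exp θ - 1))) := by
    simp_rw [hprod]
    rw [integral_fintype_prod_eq_pow, hint, Fintype.card_fin, Real.exp_nat_mul]
    refine pow_le_pow_left₀ ?_ ?_ m
    · rw [← hint]
      refine integral_nonneg fun y => ?_
      by_cases h : y ∈ S <;> simp [hw, h, Real.exp_nonneg]
    · rw [add_comm]; exact Real.add_one_le_exp _
  have hset : {z | b ≤ X z} = {z | Real.exp b ≤ Real.exp (X z)} := by
    ext z; simp
  rw [hset, ← ofReal_measureReal, Real.exp_add, Real.exp_neg]
  apply ENNReal.ofReal_le_ofReal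
  rw [inv_mul_eq_div, le_div_iff₀ (Real.exp_pos b), mul_comm]
  exact hmk.trans hE

/-- `e^θ - 1 ≤ θ + θ²`, weighted by a mass `q` lying on the favourable side of `p`. -/
lemma mul_exp_sub_one_le {p q θ : ℝ} (hp : 0 ≤ p) (hθ : |θ| ≤ 1)
    (h : (0 ≤ θ ∧ q ≤ p) ∨ (θ ≤ 0 ∧ p ≤ q)) :
    q * (Real.exp θ - 1) ≤ p * (θ + θ ^ 2) := by
  have h1 : Real.exp θ - 1 ≤ θ + θ ^ 2 := by
    have := (abs_le.1 (Real.abs_exp_sub_one_sub_id_le hθ)).2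
    linarith
  refine le_trans ?_ (mul_le_mul_of_nonneg_left h1 hp)
  rcases h with ⟨h0, hq⟩ | ⟨h0, hq⟩
  · exact mul_le_mul_of_nonneg_right hq (by linarith [Real.one_le_exp h0])
  · exact mul_le_mul_of_nonpos_right hq (by linarith [Real.exp_le_one_iff.2 h0])

end Tail

/-! ### Uniform deviation bounds for nested families of sets around the data points -/

section Uniform

variable {Ω : Type*} [MeasurableSpace Ω] (μ : Measure Ω) [IsProbabilityMeasure μ]

/-- Conditioning on one coordinate of an independent sample. -/
lemma measure_pi_le_of_slices {m : ℕ} (i : Fin (m + 1)) {T : Set (Ω × (Fin m → Ω))}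
    (hT : MeasurableSet T) {q : ℝ≥0∞}
    (h : ∀ y, (Measure.pi fun _ : Fin m => μ) {z | (y, z) ∈ T} ≤ q) :
    (Measure.pi fun _ : Fin (m + 1) => μ) {x | (x i, fun j => x (i.succAbove j)) ∈ T} ≤ q := by
  have hp := measurePreserving_piFinSuccAbove (fun _ : Fin (m + 1) => μ) i
  have h1 := hp.measure_preimage hT.nullMeasurableSet
  have h2 : (MeasurableEquiv.piFinSuccAbove (fun _ : Fin (m + 1) => Ω) i) ⁻¹' T =
      {x | (x i, fun j => x (i.succAbove j)) ∈ T} := rfl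
  rw [h2] at h1
  rw [h1, Measure.prod_apply hT]
  calc ∫⁻ y, (Measure.pi fun _ : Fin m => μ) (Prod.mk y ⁻¹' T) ∂μ ≤ ∫⁻ _, q ∂μ :=
        lintegral_mono fun y => h y
    _ = q := by simp

lemma ncard_succAbove {m : ℕ} (i : Fin (m + 1)) (P : Fin (m + 1) → Prop) :
    Set.ncard {j | P (i.succAbove j)} = Set.ncard {j | j ≠ i ∧ P j} := by
  rw [← Set.ncard_image_of_injective _ (Fin.succAbove_right_injective (p := i))]
  congr 1
  ext j
  constructor
  · rintro ⟨l, hl, rfl⟩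
    exact ⟨Fin.succAbove_ne i l, hl⟩
  · rintro ⟨hj, hP⟩
    obtain ⟨l, rfl⟩ := Fin.exists_succAbove_eq hj
    exact ⟨l, hP, rfl⟩

/-- With high probability, all sublevel sets of `G (x i)` with mass at least `p` contain more than
`a` of the other sample points. -/
lemma exists_uniform_lower {m : ℕ} (i : Fin (m + 1)) {G : Ω → Ω → ℝ}
    (hG : Measurable (Function.uncurry G)) {p θ : ℝ} (a : ℝ) (hp : 0 ≤ p) (hp1 : p ≤ 1)
    (hθ : 0 ≤ θ) (hθ1 : θ ≤ 1) :
    ∃ N : Set (Fin (m + 1) → Ω),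
      (Measure.pi fun _ : Fin (m + 1) => μ) N ≤
        ENNReal.ofReal (Real.exp (θ * a + m * (p * (-θ + θ ^ 2)))) ∧
      ∀ x ∉ N, ∀ t, p ≤ μ.real {w | G (x i) w ≤ t} →
        a < (Set.ncard {j | j ≠ i ∧ G (x i) (x j) ≤ t} : ℝ) := by
  -- One random count serves all `t`: if `z` is outside the sublevel set at `t`, that set lies in
  -- the open sublevel set of `z`, so `h ≥ p`. Thus the points with `h < p`, of mass at least `p`
  -- given the centre, lie in every sublevel set of mass at least `p`.
  set h : Ω × Ω → ℝ≥0∞ := fun y => μ {w | G y.1 w < G y.1 y.2} with hh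
  have hhm : Measurable h := by
    have : MeasurableSet {v : (Ω × Ω) × Ω | G v.1.1 v.2 < G v.1.1 v.1.2} :=
      measurableSet_lt (hG.comp ((measurable_fst.comp measurable_fst).prodMk measurable_snd))
        (hG.comp measurable_fst)
    exact measurable_measure_prodMk_left this
  have hpm : ∀ j : Fin m, MeasurableSet
      {y : Ω × (Fin m → Ω) | h (y.1, y.2 j) < ENNReal.ofReal p} := fun j =>
    measurableSet_lt (hhm.comp (measurable_fst.prodMk
      ((measurable_pi_apply j).comp measurable_snd))) measurable_const
  set T : Set (Ω × (Fin m → Ω)) :=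
    {y | (Set.ncard {j | h (y.1, y.2 j) < ENNReal.ofReal p} : ℝ) ≤ a} with hT
  have hTm : MeasurableSet T := measurableSet_le (measurable_ncard_setOf hpm) measurable_const
  refine ⟨{x | (x i, fun j => x (i.succAbove j)) ∈ T},
    measure_pi_le_of_slices μ i hTm fun y => ?_, fun x hx t ht => ?_⟩
  · set S : Set Ω := {z | h (y, z) < ENNReal.ofReal p} with hS
    have hSm : MeasurableSet S := measurableSet_lt (hhm.comp measurable_prodMk_left) measurable_const
    have hgy : Measurable (G y) := hG.comp measurable_prodMk_left
    have hpS : p ≤ μ.real S := by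
      have := le_measure_lower_quantile μ hgy (p := ENNReal.ofReal p)
        (ENNReal.ofReal_le_one.2 hp1)
      exact (ENNReal.ofReal_le_iff_le_toReal (measure_ne_top _ _)).1 this
    refine le_trans (measure_mono ?_) ((measure_le_mul_ncard_le μ hSm m (-θ) (-(θ * a))).trans ?_)
    · intro z hz
      have hz' : (Set.ncard {j | z j ∈ S} : ℝ) ≤ a := hz
      have := mul_le_mul_of_nonneg_left hz' hθ
      simp only [Set.mem_ofPred_eq]
      linarith
    · apply ENNReal.ofReal_le_ofReal
      apply Real.exp_le_exp.2
      have h1 := mul_exp_sub_one_le (q := μ.real S) (θ := -θ) hp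
        (by rwa [abs_neg, abs_of_nonneg hθ]) (Or.inr ⟨by linarith, hpS⟩)
      rw [neg_neg, ← neg_sq θ]
      gcongr
  · by_contra hcon
    refine hx ?_
    refine le_trans ?_ (not_lt.1 hcon)
    rw [← ncard_succAbove i fun j => G (x i) (x j) ≤ t]
    refine Nat.cast_le.2 (Set.ncard_le_ncard (fun j hj => ?_) (Set.toFinite _))
    by_contra hlt
    have hlt' : t < G (x i) (x (i.succAbove j)) := not_le.1 hlt
    have h1 : ENNReal.ofReal p ≤ h (x i, x (i.succAbove j)) :=
      ((ENNReal.ofReal_le_iff_le_toReal (measure_ne_top _ _)).2 ht).trans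
        (measure_mono fun w hw => lt_of_le_of_lt hw hlt')
    exact absurd hj (not_lt.2 h1)

/-- With high probability, all sublevel sets of `G (x i)` with mass at most `p` contain fewer than
`a` of the other sample points. -/
lemma exists_uniform_upper {m : ℕ} (i : Fin (m + 1)) {G : Ω → Ω → ℝ}
    (hG : Measurable (Function.uncurry G)) {p θ : ℝ} (a : ℝ) (hp : 0 ≤ p)
    (hθ : 0 ≤ θ) (hθ1 : θ ≤ 1) :
    ∃ N : Set (Fin (m + 1) → Ω),
      (Measure.pi fun _ : Fin (m + 1) => μ) N ≤
        ENNReal.ofReal (Real.exp (-(θ * a) + m * (p * (θ + θ ^ 2)))) ∧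
      ∀ x ∉ N, ∀ t, μ.real {w | G (x i) w ≤ t} ≤ p →
        (Set.ncard {j | j ≠ i ∧ G (x i) (x j) ≤ t} : ℝ) < a := by
  -- Dually, every sublevel set of mass at most `p` is contained in `{h ≤ p}`, whose mass is at most
  -- `p`.
  set h : Ω × Ω → ℝ≥0∞ := fun y => μ {w | G y.1 w ≤ G y.1 y.2} with hh
  have hhm : Measurable h := by
    have : MeasurableSet {v : (Ω × Ω) × Ω | G v.1.1 v.2 ≤ G v.1.1 v.1.2} :=
      measurableSet_le (hG.comp ((measurable_fst.comp measurable_fst).prodMk measurable_snd))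
        (hG.comp measurable_fst)
    exact measurable_measure_prodMk_left this
  have hpm : ∀ j : Fin m, MeasurableSet
      {y : Ω × (Fin m → Ω) | h (y.1, y.2 j) ≤ ENNReal.ofReal p} := fun j =>
    measurableSet_le (hhm.comp (measurable_fst.prodMk
      ((measurable_pi_apply j).comp measurable_snd))) measurable_const
  set T : Set (Ω × (Fin m → Ω)) :=
    {y | a ≤ (Set.ncard {j | h (y.1, y.2 j) ≤ ENNReal.ofReal p} : ℝ)} with hT
  have hTm : MeasurableSet T := measurableSet_le measurable_const (measurable_ncard_setOf hpm)
  refine ⟨{x | (x i, fun j => x (i.succAbove j)) ∈ T},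
    measure_pi_le_of_slices μ i hTm fun y => ?_, fun x hx t ht => ?_⟩
  · set S : Set Ω := {z | h (y, z) ≤ ENNReal.ofReal p} with hS
    have hSm : MeasurableSet S := measurableSet_le (hhm.comp measurable_prodMk_left) measurable_const
    have hgy : Measurable (G y) := hG.comp measurable_prodMk_left
    have hpS : μ.real S ≤ p :=
      ENNReal.toReal_le_of_le_ofReal hp (measure_upper_quantile_le μ hgy (ENNReal.ofReal p))
    refine le_trans (measure_mono ?_) ((measure_le_mul_ncard_le μ hSm m θ (θ * a)).trans ?_)
    · intro z hz
      have hz' : a ≤ (Set.ncard {j | z j ∈ S} : ℝ) := hz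
      exact mul_le_mul_of_nonneg_left hz' hθ
    · apply ENNReal.ofReal_le_ofReal
      apply Real.exp_le_exp.2
      have h1 := mul_exp_sub_one_le (q := μ.real S) (θ := θ) hp
        (by rwa [abs_of_nonneg hθ]) (Or.inl ⟨hθ, hpS⟩)
      gcongr
  · by_contra hcon
    refine hx ?_
    refine le_trans (not_lt.1 hcon) ?_
    rw [← ncard_succAbove i fun j => G (x i) (x j) ≤ t]
    refine Nat.cast_le.2 (Set.ncard_le_ncard (fun j hj => ?_) (Set.toFinite _))
    have hj' : G (x i) (x (i.succAbove j)) ≤ t := hj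
    refine (measure_mono (t := {w | G (x i) w ≤ t}) fun w hw => le_trans hw hj').trans ?_
    exact (ENNReal.le_ofReal_iff_toReal_le (measure_ne_top _ _) hp).2 ht

end Uniform

/-! ### The law of a density -/

section Density

variable {d : ℕ}

/-- The law on `ℝ^d` with density `f`. -/
def densityLaw (f : E d → ℝ) : Measure (E d) :=
  volume.withDensity fun x => ENNReal.ofReal (f x)

lemma IsDensityOn.isProbabilityMeasure {f : E d → ℝ} {𝒳 : Set (E d)} (hf : IsDensityOn f 𝒳) :
    IsProbabilityMeasure (densityLaw f) :=
  ⟨by rw [densityLaw, withDensity_apply _ MeasurableSet.univ, Measure.restrict_univ,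
    hf.lintegral_eq_one]⟩

lemma IsDensityOn.measure_compl_support {f : E d → ℝ} {𝒳 : Set (E d)} (hf : IsDensityOn f 𝒳) :
    densityLaw f 𝒳ᶜ = 0 := by
  have h0 : densityLaw f {x | f x = 0} = 0 := by
    have hm : MeasurableSet {x | f x = 0} := hf.measurable (measurableSet_singleton 0)
    rw [densityLaw, withDensity_apply _ hm,
      setLIntegral_congr_fun (g := fun _ => 0) hm fun x (hx : f x = 0) => by simp [hx]]
    simp
  exact measure_mono_null (fun x hx => hf.zero_outside x hx) h0

lemma mul_volume_le_densityLaw {f : E d → ℝ} {𝒳 : Set (E d)} (hf : IsDensityOn f 𝒳)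
    {T : Set (E d)} (hT : MeasurableSet T) {l : ℝ} (hl : 0 ≤ l) (h : ∀ x ∈ T, l ≤ f x) :
    l * volume.real T ≤ (densityLaw f).real T := by
  have := hf.isProbabilityMeasure
  have h1 : ENNReal.ofReal l * volume T ≤ densityLaw f T := by
    rw [densityLaw, withDensity_apply _ hT, ← setLIntegral_const]
    exact setLIntegral_mono' hT fun x hx => ENNReal.ofReal_le_ofReal (h x hx)
  have h2 := ENNReal.toReal_mono (measure_ne_top _ _) h1
  rwa [ENNReal.toReal_mul, ENNReal.toReal_ofReal hl] at h2

lemma densityLaw_le_mul_volume {f : E d → ℝ} {T : Set (E d)} (hT : MeasurableSet T)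
    (hfin : volume T ≠ ∞) {l : ℝ} (hl : 0 ≤ l) (h : ∀ x ∈ T, f x ≤ l) :
    (densityLaw f).real T ≤ l * volume.real T := by
  have h1 : densityLaw f T ≤ ENNReal.ofReal l * volume T := by
    rw [densityLaw, withDensity_apply _ hT, ← setLIntegral_const]
    exact setLIntegral_mono' hT fun x hx => ENNReal.ofReal_le_ofReal (h x hx)
  have h2 := ENNReal.toReal_mono (ENNReal.mul_ne_top ENNReal.ofReal_ne_top hfin) h1
  rwa [ENNReal.toReal_mul, ENNReal.toReal_ofReal hl] at h2

end Density

/-! ### Balls and half-balls -/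

section Volume

variable {d : ℕ}

lemma unitBallVol_pos (d : ℕ) : 0 < unitBallVol d :=
  ENNReal.toReal_pos (Metric.measure_closedBall_pos volume _ one_pos).ne'
    measure_closedBall_lt_top.ne

lemma volume_real_closedBall (x : E d) {r : ℝ} (hr : 0 ≤ r) :
    volume.real (Metric.closedBall x r) = unitBallVol d * r ^ d := by
  rw [measureReal_def, Measure.addHaar_closedBall' volume x hr, ENNReal.toReal_mul,
    ENNReal.toReal_ofReal (by positivity), finrank_euclideanSpace_fin, mul_comm, unitBallVol]

/-- The half of the ball `B(y, ρ)` that lies on the side of `x`. -/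
def halfBall (x y : E d) (ρ : ℝ) : Set (E d) :=
  {z | dist z y ≤ ρ ∧ 0 ≤ inner ℝ (z - y) (x - y)}

lemma measurableSet_halfBall (x y : E d) (ρ : ℝ) : MeasurableSet (halfBall x y ρ) := by
  have h1 : IsClosed {z : E d | dist z y ≤ ρ} := isClosed_le (by fun_prop) (by fun_prop)
  have h2 : IsClosed {z : E d | 0 ≤ inner ℝ (z - y) (x - y)} :=
    isClosed_le (by fun_prop) (by fun_prop)
  exact (h1.inter h2).measurableSet

/-- The point reflection in `y` preserves volume, and the half-ball and its reflection cover the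
ball. -/
lemma volume_real_halfBall (x y : E d) {ρ : ℝ} (hρ : 0 ≤ ρ) :
    unitBallVol d * ρ ^ d / 2 ≤ volume.real (halfBall x y ρ) := by
  set τ : E d → E d := fun z => y + y - z with hτ
  have hmp : MeasurePreserving τ volume volume := Measure.measurePreserving_sub_left volume (y + y)
  have h1 : volume (τ ⁻¹' halfBall x y ρ) = volume (halfBall x y ρ) :=
    hmp.measure_preimage (measurableSet_halfBall x y ρ).nullMeasurableSet
  have hsub : Metric.closedBall y ρ ⊆ halfBall x y ρ ∪ τ ⁻¹' halfBall x y ρ := by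
    intro z hz
    rcases le_total 0 (inner ℝ (z - y) (x - y)) with h | h
    · exact Or.inl ⟨hz, h⟩
    · have hzy : τ z - y = -(z - y) := by simp only [hτ]; abel
      refine Or.inr ⟨?_, ?_⟩
      · rw [dist_eq_norm, hzy, norm_neg, ← dist_eq_norm]; exact hz
      · rw [hzy, inner_neg_left]; linarith
  have hfin : volume (halfBall x y ρ) ≠ ∞ :=
    ne_top_of_le_ne_top measure_closedBall_lt_top.ne
      (measure_mono (t := Metric.closedBall y ρ) fun z hz => hz.1)
  have h2 : volume (Metric.closedBall y ρ) ≤ volume (halfBall x y ρ) + volume (halfBall x y ρ) := by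
    refine (measure_mono hsub).trans ((measure_union_le _ _).trans ?_)
    rw [h1]
  have h3 := ENNReal.toReal_mono (ENNReal.add_ne_top.2 ⟨hfin, hfin⟩) h2
  rw [ENNReal.toReal_add hfin hfin] at h3
  have h4 := volume_real_closedBall y hρ
  simp only [measureReal_def] at h4 ⊢
  linarith

end Volume

/-! ### Nodes of the graph -/

lemma mem_nodes_iff {d n : ℕ} (x : Fin n → E d) (k : ℕ) {r : ℝ} (hr : 0 ≤ r) (i : Fin n) :
    i ∈ nodes x k r ↔ k ≤ Set.ncard {j : Fin n | dist (x j) (x i) ≤ r} := by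
  have hset : {j : Fin n | dist (x j) (x i) ≤ r} =
      {j : Fin n | edist (x j) (x i) ≤ ENNReal.ofReal r} := by
    ext j
    simp only [Set.mem_ofPred_eq, edist_dist]
    exact (ENNReal.ofReal_le_ofReal_iff hr).symm
  rw [hset]
  refine ⟨fun h => ?_, fun h => (sInf_le h : kRadius x k i ≤ _)⟩
  by_contra hk
  set c := ENNReal.ofReal r with hc
  -- The infimum is attained: `b` is the next distance beyond `c` (or `∞`), and the count does not
  -- change on `[c, b)`.
  have hex : ∃ b : ℝ≥0∞, c < b ∧ ∀ j, edist (x j) (x i) < b → edist (x j) (x i) ≤ c := by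
    by_cases hne : (Finset.univ.filter fun j => c < edist (x j) (x i)).Nonempty
    · obtain ⟨j₀, hj₀, hmin⟩ := Finset.exists_min_image _ (fun j => edist (x j) (x i)) hne
      refine ⟨edist (x j₀) (x i), (Finset.mem_filter.1 hj₀).2, fun j hj => ?_⟩
      by_contra hlt
      exact absurd hj (not_lt.2 (hmin j (Finset.mem_filter.2 ⟨Finset.mem_univ _, not_le.1 hlt⟩)))
    · refine ⟨∞, ENNReal.ofReal_lt_top, fun j _ => ?_⟩
      by_contra hlt
      exact hne ⟨j, Finset.mem_filter.2 ⟨Finset.mem_univ _, not_le.1 hlt⟩⟩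
  obtain ⟨b, hcb, hb⟩ := hex
  obtain ⟨ρ, hρ, hρb⟩ := sInf_lt_iff.1 (lt_of_le_of_lt (show kRadius x k i ≤ c from h) hcb)
  refine hk (le_trans (show k ≤ _ from hρ) (Set.ncard_le_ncard (fun j hj => ?_) (Set.toFinite _)))
  exact hb j (lt_of_le_of_lt hj hρb)

/-! ### Levels -/

section Level

variable {d : ℕ} {f : E d → ℝ} {𝒳 A A' : Set (E d)} {σ ε : ℝ}

lemma level_comm (f : E d → ℝ) (σ : ℝ) (A A' : Set (E d)) : level f σ A A' = level f σ A' A := by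
  rw [level, level, Set.union_comm]

lemma level_le (hf : IsDensityOn f 𝒳) {y : E d} (hy : y ∈ Metric.cthickening σ A) :
    level f σ A A' ≤ f y :=
  csInf_le ⟨0, by rintro _ ⟨z, -, rfl⟩; exact hf.nonneg z⟩ ⟨y, Or.inl hy, rfl⟩

/-- The supremum over `S_σ` is nonnegative, also with the default value `0` on the empty set, so the
strict inequality forces positivity. -/
lemma Separated.level_pos (hf : IsDensityOn f 𝒳) (hε : ε < 1) (h : Separated f 𝒳 σ ε A A') :
    0 < level f σ A A' := by
  obtain ⟨S, -, -, -, hlt⟩ := h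
  have h0 : 0 ≤ sSup (f '' Metric.cthickening σ S) :=
    Real.sSup_nonneg (by rintro _ ⟨z, -, rfl⟩; exact hf.nonneg z)
  exact pos_of_mul_pos_right (lt_of_le_of_lt h0 hlt) (by linarith)

lemma closedBall_subset_cthickening_of_dist_le {y z : E d} {r : ℝ} (hy : y ∈ A)
    (h : dist z y + r ≤ σ) : Metric.closedBall z r ⊆ Metric.cthickening σ A := by
  intro w hw
  refine Metric.mem_cthickening_of_dist_le w y σ A hy ?_
  have := dist_triangle w z y
  have hw' : dist w z ≤ r := hw
  linarith

lemma level_mul_le_of_closedBall (hf : IsDensityOn f 𝒳) (hl : 0 ≤ level f σ A A') {y z : E d}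
    {r : ℝ} (hr : 0 ≤ r) (hy : y ∈ A) (h : dist z y + r ≤ σ) :
    unitBallVol d * r ^ d * level f σ A A' ≤ (densityLaw f).real (Metric.closedBall z r) := by
  have := mul_volume_le_densityLaw hf (Metric.isClosed_closedBall (x := z)
    (ε := r)).measurableSet hl fun w hw =>
      level_le (A' := A') hf (closedBall_subset_cthickening_of_dist_le hy h hw)
  rwa [volume_real_closedBall z hr, mul_comm] at this

end Level

/-! ### Separation and connectedness for a well-behaved sample -/

section Deterministic

variable {d n k : ℕ} {f : E d → ℝ} {𝒳 A A' : Set (E d)} {σ ε α r : ℝ} {x : Fin n → E d}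

lemma disconnectedInGraph_of_sample (hf : IsDensityOn f 𝒳) (hα : α ≤ 2) (hr : 0 ≤ r)
    (hrσ : r ≤ σ / 2) (hgap : NoGaps 𝒳 σ)
    (hsep : Separated f 𝒳 σ ε A A') (hx : ∀ i, x i ∈ 𝒳)
    (hupper : ∀ i, (densityLaw f).real (Metric.closedBall (x i) r) ≤
        (1 - ε) * (unitBallVol d * r ^ d * level f σ A A') →
      Set.ncard {j | dist (x j) (x i) ≤ r} < k) :
    DisconnectedInGraph x k α r A A' := by
  obtain ⟨S, hS𝒳, hpath, hbdd, hlt⟩ := hsep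
  -- Otherwise the `r`-ball around the node lies in `S_σ`, where `f` is too small for it to hold `k`
  -- points.
  have hfar : ∀ i : nodes x k r, ∀ s ∈ S, σ / 2 < dist s (x i) := by
    intro i s hs
    by_contra hcon
    have hsub : Metric.closedBall (x i) r ⊆ Metric.cthickening σ S :=
      closedBall_subset_cthickening_of_dist_le hs (by rw [dist_comm]; linarith)
    have h0 : 0 ≤ sSup (f '' Metric.cthickening σ S) :=
      Real.sSup_nonneg (by rintro _ ⟨z, -, rfl⟩; exact hf.nonneg z)
    have h1 := densityLaw_le_mul_volume (f := f) (Metric.isClosed_closedBall (x := x i)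
      (ε := r)).measurableSet measure_closedBall_lt_top.ne h0
      fun w hw => le_csSup hbdd ⟨w, hsub hw, rfl⟩
    rw [volume_real_closedBall _ hr] at h1
    have hv : 0 ≤ unitBallVol d * r ^ d :=
      mul_nonneg (unitBallVol_pos d).le (pow_nonneg hr d)
    have h2 := hupper i (h1.trans (by nlinarith [mul_le_mul_of_nonneg_right hlt.le hv]))
    exact absurd ((mem_nodes_iff x k hr i).1 i.2) (not_le.2 h2)
  have hstep : ∀ i j : nodes x k r, (linkGraph x k α r).Reachable i j →
      JoinedIn (𝒳 \ S) (x i) (x j) := by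
    rintro i j ⟨w⟩
    induction w with
    | @nil u =>
      refine JoinedIn.refl ⟨hx _, fun hs => ?_⟩
      have := hfar u _ hs
      rw [dist_self] at this
      linarith
    | @cons u v _ huv _ ih =>
      refine JoinedIn.trans ?_ ih
      have hd : dist (x u) (x v) ≤ σ := by
        have := huv.2
        nlinarith
      refine (hgap _ (hx u) _ (hx v) hd).mono fun y hy => ⟨hy.1, fun hs => ?_⟩
      rcases hy.2 with h | h
      · exact absurd (hfar u y hs) (not_lt.2 h)
      · exact absurd (hfar v y hs) (not_lt.2 h)
  intro i j hi hj hreach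
  obtain ⟨γ, hγ⟩ := hstep i j hreach
  obtain ⟨t, ht⟩ := hpath _ hi _ hj γ fun t => (hγ t).1
  exact (hγ t).2 ht

lemma connectedInGraph_of_sample (hf : IsDensityOn f 𝒳) (hd : 1 ≤ d) (hα : √2 ≤ α) (hr : 0 < r)
    (hrσ : r ≤ σ / 2) (hAc : IsPathConnected A) (hl : 0 ≤ level f σ A A')
    (hlower : ∀ i, unitBallVol d * r ^ d * level f σ A A' ≤
        (densityLaw f).real (Metric.closedBall (x i) r) →
      k ≤ Set.ncard {j | dist (x j) (x i) ≤ r})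
    (hhalf : ∀ i y, dist (x i) y = r → unitBallVol d * r ^ d * level f σ A A' / 4 ≤
        (densityLaw f).real (halfBall (x i) y ((1 - 1 / (2 * d)) * r)) →
      ∃ j, dist (x i) (x j) ≤ √2 * r ∧ dist (x j) y < r) :
    ConnectedInGraph x k α r A := by
  have hd' : (1 : ℝ) ≤ d := by exact_mod_cast hd
  have hnode : ∀ i, ∀ y ∈ A, dist (x i) y ≤ r → i ∈ nodes x k r := by
    intro i y hy hdist
    rw [mem_nodes_iff x k hr.le]
    exact hlower i (level_mul_le_of_closedBall hf hl hr.le hy (by linarith))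
  have hmass : ∀ i, ∀ y ∈ A, unitBallVol d * r ^ d * level f σ A A' / 4 ≤
      (densityLaw f).real (halfBall (x i) y ((1 - 1 / (2 * d)) * r)) := by
    intro i y hy
    have ha : 1 / (2 * (d : ℝ)) ≤ 1 / 2 := by
      rw [div_le_div_iff₀ (by positivity) (by norm_num)]; linarith
    have hρ : 0 ≤ (1 - 1 / (2 * (d : ℝ))) * r := mul_nonneg (by linarith) hr.le
    have h1 := mul_volume_le_densityLaw hf
      (measurableSet_halfBall (x i) y ((1 - 1 / (2 * d)) * r)) hl fun w hw =>
        level_le (A := A) (A' := A') (σ := σ) hf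
          (Metric.mem_cthickening_of_dist_le w y σ A hy (hw.1.trans (by
            have : 0 ≤ 1 / (2 * (d : ℝ)) := by positivity
            nlinarith)))
    have h2 := volume_real_halfBall (x i) y hρ
    -- Bernoulli's inequality: shrinking the radius by `1 - 1/(2d)` loses at most half the volume,
    -- and halving the ball the other half, hence the `1/4`.
    have hb : (1 / 2 : ℝ) ≤ (1 - 1 / (2 * (d : ℝ))) ^ d := by
      have := one_add_mul_le_pow (a := -(1 / (2 * (d : ℝ)))) (by linarith) d
      refine le_trans (le_of_eq ?_) (this.trans (le_of_eq (by ring)))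
      field_simp
      ring
    refine le_trans ?_ h1
    refine le_trans ?_ (mul_le_mul_of_nonneg_left h2 hl)
    rw [mul_pow]
    have hv : 0 ≤ unitBallVol d * r ^ d * level f σ A A' :=
      mul_nonneg (mul_nonneg (unitBallVol_pos d).le (pow_nonneg hr.le d)) hl
    nlinarith [mul_le_mul_of_nonneg_left hb hv]
  have hsqrt : (1 : ℝ) ≤ √2 := Real.one_le_sqrt.2 (by norm_num)
  refine ⟨fun i hi => hnode i _ hi (by rw [dist_self]; exact hr.le), fun i j hi hj => ?_⟩
  have hlink : ∀ a b : nodes x k r, dist (x a) (x b) ≤ √2 * r →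
      (linkGraph x k α r).Reachable a b := by
    intro a b hab
    by_cases h : a = b
    · rw [h]
    · exact SimpleGraph.Adj.reachable
        (show (linkGraph x k α r).Adj a b from ⟨h, hab.trans (by gcongr)⟩)
  obtain ⟨γ, hγ⟩ := hAc.joinedIn _ hi _ hj
  -- The times at which the path is within `r` of the component of `i`. A last such time `t < 1` is
  -- contradictory once some node of the component is strictly closer than `r`.
  set T : Set unitInterval := ⋃ c ∈ {c : nodes x k r | (linkGraph x k α r).Reachable i c},
    {t | dist (γ t) (x c) ≤ r} with hT
  have hTc : IsCompact T := by
    refine IsClosed.isCompact ((Set.toFinite _).isClosed_biUnion fun c _ => ?_)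
    exact isClosed_le (γ.continuous.dist continuous_const) continuous_const
  have hmemT : ∀ t, t ∈ T ↔ ∃ c : nodes x k r, (linkGraph x k α r).Reachable i c ∧
      dist (γ t) (x c) ≤ r := fun t => by simp [hT]
  have h0T : (0 : unitInterval) ∈ T :=
    (hmemT 0).2 ⟨i, SimpleGraph.Reachable.refl i, by rw [γ.source, dist_self]; exact hr.le⟩
  obtain ⟨t, htT, htmax⟩ := hTc.exists_isGreatest ⟨0, h0T⟩
  obtain ⟨c, hic, hct⟩ := (hmemT t).1 htT
  by_cases ht1 : t = 1
  · refine hic.trans (hlink c j ?_)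
    rw [ht1, γ.target, dist_comm] at hct
    nlinarith
  exfalso
  have hclose : ∃ e : nodes x k r, (linkGraph x k α r).Reachable i e ∧ dist (γ t) (x e) < r := by
    rcases hct.lt_or_eq with h | h
    · exact ⟨c, hic, h⟩
    · obtain ⟨e, he1, he2⟩ := hhalf c (γ t) (by rw [dist_comm]; exact h) (hmass c _ (hγ t))
      exact ⟨⟨e, hnode e _ (hγ t) he2.le⟩, hic.trans (hlink _ _ he1), by rw [dist_comm]; exact he2⟩
  obtain ⟨e, hie, het⟩ := hclose
  have hopen : IsOpen {s : unitInterval | dist (γ s) (x e) < r} :=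
    isOpen_lt (γ.continuous.dist continuous_const) continuous_const
  have htlt : t < 1 := lt_of_le_of_ne unitInterval.le_one' ht1
  obtain ⟨u, htu, hu⟩ := exists_Ico_subset_of_mem_nhds (hopen.mem_nhds het) ⟨1, htlt⟩
  obtain ⟨s, hts, hsu⟩ := exists_between htu
  have hsT : s ∈ T := (hmemT s).2 ⟨e, hie, (show dist (γ s) (x e) < r from hu ⟨hts.le, hsu⟩).le⟩
  exact absurd (htmax hsT) (not_le.2 hts)

end Deterministic

/-! ### A nested family of regions around a data point -/

section Gauge

variable {d : ℕ}

/-- The gauge of the nested family of regions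
`{w ≠ x | ‖w - x‖ ≤ √2 r ∧ ‖w - x‖ ^ 2 ≤ 2 r (⟪w - x, v⟫ - η ‖w - x‖)}`: a point lies in
the region of parameter `r` if its gauge is at most `-1 / r`. -/
def regionGauge (η : ℝ) (v x w : E d) : ℝ :=
  max (-(√2 / ‖w - x‖)) (2 * (η * ‖w - x‖ - inner ℝ (w - x) v) / ‖w - x‖ ^ 2)

lemma measurable_regionGauge (η : ℝ) (v : E d) :
    Measurable (Function.uncurry (regionGauge η v)) := by
  have hsub : Measurable fun p : E d × E d => p.2 - p.1 := measurable_snd.sub measurable_fst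
  have hin : Measurable fun p : E d × E d => inner ℝ (p.2 - p.1) v :=
    hsub.inner measurable_const
  exact ((measurable_const.div hsub.norm).neg).max
    ((((hsub.norm.const_mul η).sub hin).const_mul 2).div (hsub.norm.pow_const 2))

lemma regionGauge_le_iff (η : ℝ) (v x w : E d) {r : ℝ} (hr : 0 < r) :
    regionGauge η v x w ≤ -(1 / r) ↔ w ≠ x ∧ ‖w - x‖ ≤ √2 * r ∧
      ‖w - x‖ ^ 2 ≤ 2 * r * (inner ℝ (w - x) v - η * ‖w - x‖) := by
  by_cases hw : w = x
  -- Division by zero makes the gauge `0` at `w = x`, above every `-1/r`, so the centre is excluded.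
  · have : ¬ (0 : ℝ) ≤ -r⁻¹ := by
      have := inv_pos.2 hr
      linarith
    simp [regionGauge, hw, this]
  · have hz : 0 < ‖w - x‖ := norm_pos_iff.2 (sub_ne_zero.2 hw)
    rw [regionGauge, max_le_iff, neg_le_neg_iff, div_le_div_iff₀ hr hz,
      div_le_iff₀ (by positivity)]
    refine ⟨fun h => ⟨hw, by linarith, ?_⟩, fun h => ⟨by linarith [h.2.1], ?_⟩⟩
    · have h2 := mul_le_mul_of_nonneg_right h.2 hr.le
      have : -(1 / r) * ‖w - x‖ ^ 2 * r = -‖w - x‖ ^ 2 := by field_simp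
      linarith
    · have h2 := h.2.2
      refine le_of_mul_le_mul_right ?_ hr
      have : -(1 / r) * ‖w - x‖ ^ 2 * r = -‖w - x‖ ^ 2 := by field_simp
      linarith

lemma inner_direction_bounds {x y v : E d} {r η : ℝ} (hr : 0 < r)
    (hv : ‖v - r⁻¹ • (y - x)‖ < η) (z : E d) :
    |r * inner ℝ z v - inner ℝ z (y - x)| ≤ r * (‖v - r⁻¹ • (y - x)‖ * ‖z‖) ∧
      (z ≠ 0 → |r * inner ℝ z v - inner ℝ z (y - x)| < r * (η * ‖z‖)) := by
  have h1 : r * inner ℝ z v - inner ℝ z (y - x) = r * inner ℝ z (v - r⁻¹ • (y - x)) := by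
    rw [inner_sub_right z v, inner_smul_right]
    field_simp
  have h2 : |r * inner ℝ z v - inner ℝ z (y - x)| ≤ r * (‖v - r⁻¹ • (y - x)‖ * ‖z‖) := by
    rw [h1, abs_mul, abs_of_pos hr, mul_comm ‖v - _‖]
    exact mul_le_mul_of_nonneg_left (abs_real_inner_le_norm _ _) hr.le
  refine ⟨h2, fun hz => h2.trans_lt ?_⟩
  have : 0 < ‖z‖ := norm_pos_iff.2 hz
  gcongr

/-- Expand `‖w - y‖²` about `x`: the margin `η ‖w - x‖` in the region pays for replacing the true
direction by `v`. Strictness comes from `w ≠ x`. -/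
lemma dist_of_regionGauge_le {x y v w : E d} {r η : ℝ} (hr : 0 < r) (hxy : dist x y = r)
    (hv : ‖v - r⁻¹ • (y - x)‖ < η) (hw : regionGauge η v x w ≤ -(1 / r)) :
    dist x w ≤ √2 * r ∧ dist w y < r := by
  obtain ⟨hne, h1, h2⟩ := (regionGauge_le_iff η v x w hr).1 hw
  refine ⟨by rwa [dist_comm, dist_eq_norm], ?_⟩
  have h3 := (abs_lt.1 ((inner_direction_bounds hr hv (w - x)).2 (sub_ne_zero.2 hne))).2
  have h4 : ‖w - y‖ ^ 2 = ‖w - x‖ ^ 2 - 2 * inner ℝ (w - x) (y - x) + ‖y - x‖ ^ 2 := by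
    rw [← norm_sub_sq_real, sub_sub_sub_cancel_right]
  have h5 : ‖y - x‖ = r := by rw [← dist_eq_norm, dist_comm, hxy]
  rw [dist_eq_norm]
  refine lt_of_pow_lt_pow_left₀ 2 hr.le ?_
  rw [h4, h5]
  linarith

/-- The shrinkage leaves a slack of `6ηr²`. The change of direction and the margin of the region
each cost `2rη‖w - x‖ ≤ 3ηr²`, using `√2 ≤ 3/2`. -/
lemma halfBall_subset_region {x y v : E d} {r η : ℝ} (hr : 0 < r) (hη : 0 < η) (hη1 : 6 * η ≤ 1)
    (hxy : dist x y = r) (hv : ‖v - r⁻¹ • (y - x)‖ < η) :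
    halfBall x y ((1 - 6 * η) * r) ⊆ {w | regionGauge η v x w ≤ -(1 / r)} := by
  rintro w ⟨hw1, hw2⟩
  refine (regionGauge_le_iff η v x w hr).2 ?_
  have hyx : ‖y - x‖ = r := by rw [← dist_eq_norm, dist_comm, hxy]
  rw [dist_eq_norm] at hw1
  have hw1sq : ‖w - y‖ ^ 2 ≤ ((1 - 6 * η) * r) ^ 2 := pow_le_pow_left₀ (norm_nonneg _) hw1 2
  have h4 : ‖w - y‖ ^ 2 = ‖w - x‖ ^ 2 - 2 * inner ℝ (w - x) (y - x) + r ^ 2 := by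
    rw [← hyx, ← norm_sub_sq_real, sub_sub_sub_cancel_right]
  have h5 : inner ℝ (w - y) (x - y) = r ^ 2 - inner ℝ (w - x) (y - x) := by
    have : w - y = (w - x) - (y - x) := by abel
    rw [this, ← neg_sub y x, inner_neg_right, inner_sub_left, real_inner_self_eq_norm_sq, hyx]
    ring
  rw [h5] at hw2
  have h6 : ((1 - 6 * η) * r) ^ 2 ≤ (1 - 6 * η) * r ^ 2 := by
    rw [mul_pow]
    refine mul_le_mul_of_nonneg_right ?_ (sq_nonneg r)
    nlinarith
  have h7 : ‖w - x‖ ^ 2 ≤ (√2 * r) ^ 2 := by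
    rw [mul_pow, Real.sq_sqrt (by norm_num)]
    nlinarith [mul_pos hη (pow_pos hr 2)]
  have h8 : ‖w - x‖ ≤ √2 * r := le_of_sq_le_sq h7 (by positivity)
  have hs : √2 ≤ 3 / 2 := Real.sqrt_le_iff.2 ⟨by norm_num, by norm_num⟩
  have h9 : ‖w - x‖ ≤ 3 / 2 * r := h8.trans (by gcongr)
  refine ⟨?_, h8, ?_⟩
  · rintro rfl
    simp only [sub_self, norm_zero, inner_zero_left] at h4
    nlinarith [mul_pos hη (pow_pos hr 2)]
  · have h10 := (abs_le.1 (inner_direction_bounds hr hv (w - x)).1).1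
    have h11 : r * (‖v - r⁻¹ • (y - x)‖ * ‖w - x‖) ≤ r * (η * ‖w - x‖) := by gcongr
    have h12 : r * (η * ‖w - x‖) ≤ r * (η * (3 / 2 * r)) := by gcongr
    nlinarith

end Gauge

/-! ### A grid of directions -/

/-- The points of the grid of mesh `1 / M` in the cube `[-1, 1]^d`. -/
def gridPoint {d : ℕ} (M : ℕ) (g : Fin d → Fin (2 * M + 1)) : E d :=
  WithLp.toLp 2 fun l => -1 + (g l : ℝ) / M

lemma exists_gridPoint_near {d M : ℕ} (hd : 1 ≤ d) (hM : M = 13 * d ^ 2) {u : E d}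
    (hu : ‖u‖ ≤ 1) :
    ∃ g : Fin d → Fin (2 * M + 1), ‖gridPoint M g - u‖ < 1 / (12 * d) := by
  have hd' : (1 : ℝ) ≤ d := by exact_mod_cast hd
  have hM' : (M : ℝ) = 13 * (d : ℝ) ^ 2 := by rw [hM]; push_cast; ring
  have hMpos : (0 : ℝ) < M := by rw [hM']; positivity
  have hcoord : ∀ l, |u l| ≤ 1 := fun l => (PiLp.norm_apply_le u l).trans hu
  have hfloor : ∀ l, ⌊(u l + 1) * M⌋₊ < 2 * M + 1 := by
    intro l
    refine Nat.lt_succ_of_le (Nat.floor_le_of_le ?_)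
    push_cast
    have := (abs_le.1 (hcoord l)).2
    exact mul_le_mul_of_nonneg_right (by linarith) hMpos.le
  refine ⟨fun l => ⟨⌊(u l + 1) * M⌋₊, hfloor l⟩, ?_⟩
  set g : Fin d → Fin (2 * M + 1) := fun l => ⟨⌊(u l + 1) * M⌋₊, hfloor l⟩ with hg
  have hdiff : ∀ l, ‖(gridPoint M g - u) l‖ ≤ 1 / M := by
    intro l
    have h0 : 0 ≤ (u l + 1) * M :=
      mul_nonneg (by linarith [(abs_le.1 (hcoord l)).1]) hMpos.le
    have h1 := Nat.floor_le h0
    have h2 := Nat.lt_floor_add_one ((u l + 1) * M)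
    have h3 : (gridPoint M g - u) l = ((⌊(u l + 1) * M⌋₊ : ℝ) - (u l + 1) * M) / M := by
      simp only [gridPoint, hg, PiLp.sub_apply]
      field_simp
      ring
    rw [h3, Real.norm_eq_abs, abs_div, abs_of_pos hMpos]
    refine div_le_div_of_nonneg_right (abs_le.2 ⟨by linarith, by linarith⟩) hMpos.le
  have hsq : ‖gridPoint M g - u‖ ^ 2 ≤ d * (1 / M) ^ 2 := by
    rw [EuclideanSpace.norm_sq_eq]
    refine (Finset.sum_le_card_nsmul _ _ ((1 / (M : ℝ)) ^ 2) fun l _ =>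
      pow_le_pow_left₀ (norm_nonneg _) (hdiff l) 2).trans (le_of_eq ?_)
    simp
  -- The error is at most `√d / M`, and `M = 13d²` exceeds `12 d √d`.
  refine lt_of_pow_lt_pow_left₀ 2 (by positivity) (hsq.trans_lt ?_)
  rw [hM', one_div_pow, one_div_pow, mul_one_div, div_lt_div_iff₀ (by positivity) (by positivity)]
  have h1 : (d : ℝ) * d ^ 2 ≤ d ^ 4 := by nlinarith [pow_nonneg (by linarith : (0 : ℝ) ≤ d) 3]
  have h2 : (0 : ℝ) < (d : ℝ) ^ 4 := by positivity
  nlinarith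

/-! ### The good event -/

section GoodEvent

lemma ncard_setOf_dist_le {d n : ℕ} (x : Fin n → E d) (i : Fin n) {r : ℝ} (hr : 0 ≤ r) :
    Set.ncard {j | dist (x j) (x i) ≤ r} =
      Set.ncard {j | j ≠ i ∧ dist (x j) (x i) ≤ r} + 1 := by
  rw [← Set.ncard_insert_of_notMem (a := i) (by simp) (Set.toFinite _)]
  congr 1
  ext j
  by_cases h : j = i <;> simp [h, hr]

/-- A sample is representative if balls around its points contain about as many sample points
as they should, and half-balls next to its points are not empty. -/
structure IsRepresentative {d n : ℕ} (f : E d → ℝ) (𝒳 : Set (E d)) (k : ℕ) (s : ℝ)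
    (x : Fin n → E d) : Prop where
  mem : ∀ i, x i ∈ 𝒳
  lower : ∀ i r, 0 ≤ r → (k + s) / n ≤ (densityLaw f).real (Metric.closedBall (x i) r) →
    k ≤ Set.ncard {j | dist (x j) (x i) ≤ r}
  upper : ∀ i r, 0 ≤ r → (densityLaw f).real (Metric.closedBall (x i) r) ≤ (k - s) / n →
    Set.ncard {j | dist (x j) (x i) ≤ r} < k
  half : ∀ i y r, 0 < r → dist (x i) y = r →
    k / (4 * n) ≤ (densityLaw f).real (halfBall (x i) y ((1 - 1 / (2 * d)) * r)) →
      ∃ j, dist (x i) (x j) ≤ √2 * r ∧ dist (x j) y < r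

variable {d n k : ℕ} {f : E d → ℝ} {𝒳 : Set (E d)} {s δ : ℝ}

lemma exists_lower_event (hf : IsDensityOn f 𝒳) {m : ℕ} (hn : n = m + 1) (hs : 0 ≤ s)
    (hsk : s ≤ k) (hk : 1 ≤ k) (hkn : k + s ≤ n) (i : Fin n) :
    ∃ N : Set (Fin n → E d),
      sampleLaw f n N ≤ ENNReal.ofReal (Real.exp (-(s ^ 2 / (16 * k)))) ∧
      ∀ x ∉ N, ∀ r, 0 ≤ r →
        (k + s) / n ≤ (densityLaw f).real (Metric.closedBall (x i) r) →
        k ≤ Set.ncard {j | dist (x j) (x i) ≤ r} := by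
  subst hn
  have := hf.isProbabilityMeasure
  have hk0 : (0 : ℝ) < k := by exact_mod_cast hk
  have hn0 : (0 : ℝ) < ((m + 1 : ℕ) : ℝ) := by positivity
  have hθ1 : s / (4 * k) ≤ 1 := by rw [div_le_one (by positivity)]; linarith
  -- More than `k - 2` other points, together with `x i` itself, make `k`. The choice of `θ` gives a
  -- gain `θs = 4kθ²` against a quadratic cost of at most `(k + s)θ² ≤ 2kθ²`.
  obtain ⟨N, hN, hx⟩ := exists_uniform_lower (densityLaw f) i (G := fun x w : E d => dist w x)
    (measurable_snd.dist measurable_fst) (p := (k + s) / (m + 1 : ℕ)) (θ := s / (4 * k))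
    ((k : ℝ) - 2) (by positivity) ((div_le_one hn0).2 hkn) (by positivity) hθ1
  refine ⟨N, hN.trans (ENNReal.ofReal_le_ofReal (Real.exp_le_exp.2 ?_)), fun x hxN r hr h => ?_⟩
  · set θ := s / (4 * k) with hθ
    have hθ0 : 0 ≤ θ := by positivity
    have hmp : (k : ℝ) + s - 1 ≤ m * ((k + s) / (m + 1 : ℕ)) := by
      have h1 : (m : ℝ) * ((k + s) / (m + 1 : ℕ)) = (k + s) - (k + s) / (m + 1 : ℕ) := by
        push_cast; field_simp; ring
      rw [h1]
      linarith [(div_le_one hn0).2 hkn]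
    have hmul : θ * s = 4 * k * θ ^ 2 := by rw [hθ]; field_simp
    have hgoal : s ^ 2 / (16 * k) = k * θ ^ 2 := by rw [hθ]; field_simp; norm_num
    have h2 : (m : ℝ) * ((k + s) / (m + 1 : ℕ) * (-θ + θ ^ 2)) =
        m * ((k + s) / (m + 1 : ℕ)) * (-θ + θ ^ 2) := by ring
    have h3 : -θ + θ ^ 2 ≤ 0 := by nlinarith
    rw [h2, hgoal]
    have h4 := mul_le_mul_of_nonpos_right hmp h3
    nlinarith [sq_nonneg θ, mul_nonneg hk0.le (sq_nonneg θ),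
      mul_le_mul_of_nonneg_right hsk (sq_nonneg θ)]
  · have h1 := hx x hxN r h
    rw [ncard_setOf_dist_le x i hr]
    have h2 : (k : ℝ) < (Set.ncard {j | j ≠ i ∧ dist (x j) (x i) ≤ r} : ℝ) + 2 := by linarith
    have h3 : k < Set.ncard {j | j ≠ i ∧ dist (x j) (x i) ≤ r} + 2 := by exact_mod_cast h2
    omega

lemma exists_upper_event (hf : IsDensityOn f 𝒳) {m : ℕ} (hn : n = m + 1) (hs : 2 ≤ s)
    (hsk : s ≤ k) (hk : 1 ≤ k) (i : Fin n) :
    ∃ N : Set (Fin n → E d),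
      sampleLaw f n N ≤ ENNReal.ofReal (Real.exp (-(s ^ 2 / (16 * k)))) ∧
      ∀ x ∉ N, ∀ r, 0 ≤ r →
        (densityLaw f).real (Metric.closedBall (x i) r) ≤ (k - s) / n →
        Set.ncard {j | dist (x j) (x i) ≤ r} < k := by
  subst hn
  have := hf.isProbabilityMeasure
  have hk0 : (0 : ℝ) < k := by exact_mod_cast hk
  have hn0 : (0 : ℝ) < ((m + 1 : ℕ) : ℝ) := by positivity
  have hθ1 : s / (4 * k) ≤ 1 := by rw [div_le_one (by positivity)]; linarith
  have hp : 0 ≤ (k - s) / ((m + 1 : ℕ) : ℝ) := div_nonneg (by linarith) hn0.le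
  obtain ⟨N, hN, hx⟩ := exists_uniform_upper (densityLaw f) i (G := fun x w : E d => dist w x)
    (measurable_snd.dist measurable_fst) (θ := s / (4 * k))
    ((k : ℝ) - 1) hp (by positivity) hθ1
  refine ⟨N, hN.trans (ENNReal.ofReal_le_ofReal (Real.exp_le_exp.2 ?_)), fun x hxN r hr h => ?_⟩
  · set θ := s / (4 * k) with hθ
    have hθ0 : 0 ≤ θ := by positivity
    have hmp : m * ((k - s) / (m + 1 : ℕ)) ≤ (k : ℝ) - s := by
      have h1 : (m : ℝ) * ((k - s) / (m + 1 : ℕ)) = (k - s) - (k - s) / (m + 1 : ℕ) := by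
        push_cast; field_simp; ring
      rw [h1]
      linarith
    have hmul : θ * s = 4 * k * θ ^ 2 := by rw [hθ]; field_simp
    have hgoal : s ^ 2 / (16 * k) = k * θ ^ 2 := by rw [hθ]; field_simp; norm_num
    have h2 : (m : ℝ) * ((k - s) / (m + 1 : ℕ) * (θ + θ ^ 2)) =
        m * ((k - s) / (m + 1 : ℕ)) * (θ + θ ^ 2) := by ring
    have h3 : 0 ≤ θ + θ ^ 2 := by positivity
    rw [h2, hgoal]
    have h4 := mul_le_mul_of_nonneg_right hmp h3
    -- Here `x i` itself costs an extra `θ`, which `s ≥ 2` pays for: `θ ≤ θs/2`.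
    nlinarith [mul_nonneg (by linarith : (0 : ℝ) ≤ s) (sq_nonneg θ), mul_nonneg hθ0 (sub_nonneg.2 hs)]
  · have h1 := hx x hxN r h
    rw [ncard_setOf_dist_le x i hr]
    have h2 : (Set.ncard {j | j ≠ i ∧ dist (x j) (x i) ≤ r} : ℝ) + 1 < k := by linarith
    exact_mod_cast h2

lemma exists_half_event (hf : IsDensityOn f 𝒳) {m : ℕ} (hm : 1 ≤ m) (hn : n = m + 1) (hk : 1 ≤ k)
    (hkn : k ≤ n) (i : Fin n) (η : ℝ) (v : E d) :
    ∃ N : Set (Fin n → E d),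
      sampleLaw f n N ≤ ENNReal.ofReal (Real.exp (-((k : ℝ) / 32))) ∧
      ∀ x ∉ N, ∀ t, k / (4 * n) ≤ (densityLaw f).real {w | regionGauge η v (x i) w ≤ t} →
        ∃ j, regionGauge η v (x i) (x j) ≤ t := by
  subst hn
  have := hf.isProbabilityMeasure
  have hk0 : (0 : ℝ) < k := by exact_mod_cast hk
  have hkn' : (k : ℝ) ≤ ((m + 1 : ℕ) : ℝ) := by exact_mod_cast hkn
  have hn0 : (0 : ℝ) < ((m + 1 : ℕ) : ℝ) := by positivity
  obtain ⟨N, hN, hx⟩ := exists_uniform_lower (densityLaw f) i (measurable_regionGauge η v)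
    (p := k / (4 * (m + 1 : ℕ))) (θ := 1 / 2) 0 (by positivity)
    ((div_le_one (by positivity)).2 (by linarith)) (by norm_num) (by norm_num)
  refine ⟨N, hN.trans (ENNReal.ofReal_le_ofReal (Real.exp_le_exp.2 ?_)), fun x hxN t h => ?_⟩
  -- With `m ≥ n/2` and `θ = 1/2` the exponent is at most `-(k/8)/4`.
  · have hmp : (k : ℝ) / 8 ≤ m * (k / (4 * (m + 1 : ℕ))) := by
      have hm' : (1 : ℝ) ≤ m := by exact_mod_cast hm
      rw [← mul_div_assoc, div_le_div_iff₀ (by norm_num) (by positivity)]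
      push_cast
      nlinarith
    linarith
  · have h1 := hx x hxN t h
    have h2 : 0 < Set.ncard {j | j ≠ i ∧ regionGauge η v (x i) (x j) ≤ t} := by exact_mod_cast h1
    obtain ⟨j, hj⟩ := Set.nonempty_of_ncard_ne_zero h2.ne'
    exact ⟨j, hj.2⟩

lemma exists_representative_event (hf : IsDensityOn f 𝒳) (hd : 1 ≤ d) (hδ : 0 < δ)
    (hn2 : 2 ≤ n) (hs : 2 ≤ s) (hsk : s ≤ k) (hk : 1 ≤ k) (hkn : k + s ≤ n)
    (htail : n * Real.exp (-(s ^ 2 / (16 * k))) ≤ δ / 4)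
    (hgrid : n * ((2 * (13 * d ^ 2) + 1 : ℕ) : ℝ) ^ d * Real.exp (-((k : ℝ) / 32)) ≤ δ / 4) :
    ∃ G : Set (Fin n → E d), MeasurableSet G ∧ ENNReal.ofReal (1 - δ) ≤ sampleLaw f n G ∧
      ∀ x ∈ G, IsRepresentative f 𝒳 k s x := by
  have hprob := hf.isProbabilityMeasure
  have hprob' : IsProbabilityMeasure (sampleLaw f n) :=
    inferInstanceAs (IsProbabilityMeasure (Measure.pi fun _ => densityLaw f))
  have hd' : (1 : ℝ) ≤ d := by exact_mod_cast hd
  obtain ⟨m, rfl⟩ : ∃ m, n = m + 1 := ⟨n - 1, by omega⟩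
  set n := m + 1 with hn
  set M := 13 * d ^ 2 with hM
  have hkn' : k ≤ n := by
    have : (k : ℝ) ≤ n := by linarith
    exact_mod_cast this
  choose N₁ hN₁ hx₁ using fun i : Fin n =>
    exists_lower_event (k := k) (s := s) hf hn (by linarith) hsk hk hkn i
  choose N₂ hN₂ hx₂ using fun i : Fin n => exists_upper_event (k := k) (s := s) hf hn hs hsk hk i
  choose N₃ hN₃ hx₃ using fun v : Fin n × (Fin d → Fin (2 * M + 1)) =>
    exists_half_event (k := k) hf (by omega) hn hk hkn' v.1 (1 / (12 * d)) (gridPoint M v.2)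
  set N₀ : Fin n → Set (Fin n → E d) := fun i => {x | x i ∉ 𝒳} with hN₀def
  have hN₀ : ∀ i, sampleLaw f n (N₀ i) = 0 := by
    intro i
    exact (measurePreserving_eval (fun _ : Fin n => densityLaw f) i).quasiMeasurePreserving.preimage_null
      hf.measure_compl_support
  set B := (⋃ i, N₀ i) ∪ ((⋃ i, N₁ i) ∪ ((⋃ i, N₂ i) ∪ ⋃ v, N₃ v)) with hB
  have hsum : ∀ N : Fin n → Set (Fin n → E d),
      (∀ i, sampleLaw f n (N i) ≤ ENNReal.ofReal (Real.exp (-(s ^ 2 / (16 * k))))) →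
      sampleLaw f n (⋃ i, N i) ≤ ENNReal.ofReal (δ / 4) := by
    intro N hN
    refine (measure_iUnion_fintype_le _ _).trans ((Finset.sum_le_card_nsmul _ _ _ fun i _ => hN i).trans ?_)
    rw [nsmul_eq_mul, Finset.card_univ, Fintype.card_fin, ← ENNReal.ofReal_natCast,
      ← ENNReal.ofReal_mul (by positivity)]
    exact ENNReal.ofReal_le_ofReal htail
  have hsum₃ : sampleLaw f n (⋃ v, N₃ v) ≤ ENNReal.ofReal (δ / 4) := by
    refine (measure_iUnion_fintype_le _ _).trans ((Finset.sum_le_card_nsmul _ _ _ fun v _ => hN₃ v).trans ?_)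
    rw [nsmul_eq_mul, Finset.card_univ, ← ENNReal.ofReal_natCast,
      ← ENNReal.ofReal_mul (by positivity)]
    refine ENNReal.ofReal_le_ofReal (le_trans (le_of_eq ?_) hgrid)
    rw [Fintype.card_prod, Fintype.card_fun, Fintype.card_fin, Fintype.card_fin, Fintype.card_fin]
    push_cast
    ring
  have hBδ : sampleLaw f n B ≤ ENNReal.ofReal δ := by
    have h0 : sampleLaw f n (⋃ i, N₀ i) = 0 := measure_iUnion_null hN₀
    have hq : 0 ≤ δ / 4 := by positivity
    calc sampleLaw f n B ≤ sampleLaw f n (⋃ i, N₀ i) + (sampleLaw f n (⋃ i, N₁ i) +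
          (sampleLaw f n (⋃ i, N₂ i) + sampleLaw f n (⋃ v, N₃ v))) := by
          refine (measure_union_le _ _).trans (add_le_add_right ?_ _)
          refine (measure_union_le _ _).trans (add_le_add_right ?_ _)
          exact measure_union_le _ _
      _ ≤ 0 + (ENNReal.ofReal (δ / 4) + (ENNReal.ofReal (δ / 4) + ENNReal.ofReal (δ / 4))) := by
          rw [h0]
          gcongr
          · exact hsum N₁ hN₁
          · exact hsum N₂ hN₂
      _ = ENNReal.ofReal (δ / 4 + (δ / 4 + δ / 4)) := by
          rw [zero_add, ENNReal.ofReal_add hq (by positivity), ENNReal.ofReal_add hq hq]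
      _ ≤ ENNReal.ofReal δ := ENNReal.ofReal_le_ofReal (by linarith)
  -- The bad set need not be measurable (`𝒳` is arbitrary), so its measurable hull is removed.
  refine ⟨(toMeasurable (sampleLaw f n) B)ᶜ, (measurableSet_toMeasurable _ _).compl, ?_,
    fun x hx => ?_⟩
  · rw [prob_compl_eq_one_sub (measurableSet_toMeasurable _ _), measure_toMeasurable,
      ENNReal.ofReal_sub _ hδ.le, ENNReal.ofReal_one]
    exact tsub_le_tsub_left hBδ 1
  · have hxB : x ∉ B := fun h => hx (subset_toMeasurable _ _ h)
    simp only [hB, Set.mem_union, Set.mem_iUnion, not_or, not_exists] at hxB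
    obtain ⟨h₀, h₁, h₂, h₃⟩ := hxB
    refine ⟨fun i => not_not.1 (h₀ i), fun i => hx₁ i x (h₁ i), fun i => hx₂ i x (h₂ i), ?_⟩
    intro i y r hr hxy hmass
    have hu : ‖r⁻¹ • (y - x i)‖ ≤ 1 := by
      rw [norm_smul, norm_inv, Real.norm_eq_abs, abs_of_pos hr, ← dist_eq_norm, dist_comm, hxy,
        inv_mul_cancel₀ hr.ne']
    obtain ⟨g, hg⟩ := exists_gridPoint_near hd hM hu
    have hη : (6 : ℝ) * (1 / (12 * d)) = 1 / (2 * d) := by field_simp; norm_num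
    have hη1 : (6 : ℝ) * (1 / (12 * d)) ≤ 1 := by
      rw [hη, div_le_one (by positivity)]; linarith
    have hsub := halfBall_subset_region hr (by positivity) hη1 hxy hg
    rw [hη] at hsub
    obtain ⟨j, hj⟩ := hx₃ (i, g) x (h₃ (i, g)) (-(1 / r))
      (hmass.trans (measureReal_mono hsub))
    exact ⟨j, dist_of_regionGauge_le hr hxy hg hj⟩

end GoodEvent

/-! ### Numerical estimates -/

section Numerics

lemma log_two_le_log_two_div {δ : ℝ} (hδ : 0 < δ) (hδ1 : δ < 1) :
    (0.69 : ℝ) ≤ Real.log (2 / δ) := by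
  have h1 : Real.log 2 ≤ Real.log (2 / δ) :=
    Real.log_le_log (by norm_num) (by rw [le_div_iff₀ hδ]; linarith)
  linarith [Real.log_two_gt_d9]

/-- A bound `a e^{-b} ≤ δ / 4` from a bound on the logarithm of `a`. -/
lemma mul_exp_neg_le_quarter {δ a b : ℝ} (hδ : 0 < δ) (hδ1 : δ < 1) (ha : 0 < a)
    (h : Real.log a + 2 * Real.log (2 / δ) ≤ b) : a * Real.exp (-b) ≤ δ / 4 := by
  have h1 : Real.exp (2 * Real.log (2 / δ)) = (2 / δ) ^ 2 := by
    rw [mul_comm, Real.exp_mul, Real.exp_log (by positivity)]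
    norm_num
  have h2 : a * (2 / δ) ^ 2 ≤ Real.exp b := by
    rw [← h1]
    nth_rewrite 1 [← Real.exp_log ha]
    rw [← Real.exp_add]
    exact Real.exp_le_exp.2 h
  have h3 : a * 4 ≤ Real.exp b * δ ^ 2 := by
    rw [div_pow, mul_div_assoc', div_le_iff₀ (by positivity)] at h2
    linarith
  rw [Real.exp_neg, ← div_eq_mul_inv, div_le_div_iff₀ (Real.exp_pos b) (by norm_num)]
  have h4 : δ ^ 2 ≤ δ := by nlinarith
  nlinarith [mul_le_mul_of_nonneg_left h4 (Real.exp_pos b).le]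

/-- `D + l` is dominated by `l² D` when both are bounded below. -/
lemma add_le_sq_mul {l D : ℝ} (hl : 0.69 ≤ l) (hD : 0.69 ≤ D) : D + l ≤ 5 * (l ^ 2 * D) := by
  have h1 : 0.476 * D ≤ l ^ 2 * D := mul_le_mul_of_nonneg_right (by nlinarith) (by linarith)
  have h2 : 0.476 * l ≤ l ^ 2 * D := by nlinarith [mul_nonneg (sub_nonneg.2 hl) (sub_nonneg.2 hD)]
  linarith

variable {d n k : ℕ} {δ : ℝ}

lemma log_two_le_mul_log (hd : 1 ≤ d) (hn : 2 ≤ n) :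
    Real.log n ≤ d * Real.log n ∧ (0.69 : ℝ) ≤ Real.log n := by
  have hd' : (1 : ℝ) ≤ d := by exact_mod_cast hd
  have hn' : (2 : ℝ) ≤ n := by exact_mod_cast hn
  have h1 : Real.log 2 ≤ Real.log n := Real.log_le_log (by norm_num) hn'
  have h2 := Real.log_two_gt_d9
  exact ⟨by nlinarith, by linarith⟩

lemma tail_bound (hd : 1 ≤ d) (hn : 2 ≤ n) (hk : 1 ≤ k) (hδ : 0 < δ) (hδ1 : δ < 1) {s : ℝ}
    (hs : s ^ 2 = 400 * Real.log (2 / δ) ^ 2 * (k * (d * Real.log n))) :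
    n * Real.exp (-(s ^ 2 / (16 * k))) ≤ δ / 4 := by
  have hk0 : (0 : ℝ) < k := by exact_mod_cast hk
  obtain ⟨h1, h2⟩ := log_two_le_mul_log hd hn
  have h3 := add_le_sq_mul (log_two_le_log_two_div hδ hδ1) (h2.trans h1)
  refine mul_exp_neg_le_quarter hδ hδ1 (by positivity) ?_
  have h4 : s ^ 2 / (16 * k) = 25 * (Real.log (2 / δ) ^ 2 * (d * Real.log n)) := by
    rw [hs]; field_simp; ring
  have h5 := log_two_le_log_two_div hδ hδ1
  rw [h4]
  linarith

/-- Since `d log n` is dominated by `k ≤ n`, also `d ≤ n`. The logarithm of the grid size is then at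
most `7 d log n`, which `k/32` absorbs. -/
lemma grid_bound (hd : 1 ≤ d) (hn : 2 ≤ n) (hkn : k ≤ n) (hδ : 0 < δ) (hδ1 : δ < 1)
    (hk : 1600 * (Real.log (2 / δ) ^ 2 * (d * Real.log n)) ≤ k) :
    n * ((2 * (13 * d ^ 2) + 1 : ℕ) : ℝ) ^ d * Real.exp (-((k : ℝ) / 32)) ≤ δ / 4 := by
  have hd' : (1 : ℝ) ≤ d := by exact_mod_cast hd
  have hn' : (2 : ℝ) ≤ n := by exact_mod_cast hn
  have hkn' : (k : ℝ) ≤ n := by exact_mod_cast hkn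
  obtain ⟨h1, h2⟩ := log_two_le_mul_log hd hn
  have hl := log_two_le_log_two_div hδ hδ1
  have h3 := add_le_sq_mul hl (h2.trans h1)
  have hdn : (d : ℝ) ≤ n := by
    have : 0.69 * (d : ℝ) ≤ d * Real.log n := by nlinarith
    linarith
  have hK : Real.log ((2 * (13 * d ^ 2) + 1 : ℕ) : ℝ) ≤ 7 * Real.log n := by
    have h4 : ((2 * (13 * d ^ 2) + 1 : ℕ) : ℝ) ≤ (n : ℝ) ^ 7 := by
      have h5 : (d : ℝ) ^ 2 ≤ (n : ℝ) ^ 2 := pow_le_pow_left₀ (by linarith) hdn 2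
      have h6 : (2 : ℝ) ^ 5 ≤ (n : ℝ) ^ 5 := pow_le_pow_left₀ (by norm_num) hn' 5
      have h7 : (1 : ℝ) ≤ (n : ℝ) ^ 2 := one_le_pow₀ (by linarith)
      have h8 : (n : ℝ) ^ 7 = (n : ℝ) ^ 5 * (n : ℝ) ^ 2 := by ring
      push_cast
      rw [h8]
      nlinarith
    have h5 := Real.log_le_log (by positivity) h4
    rwa [Real.log_pow, Nat.cast_ofNat] at h5
  refine mul_exp_neg_le_quarter hδ hδ1 (by positivity) ?_
  rw [Real.log_mul (by positivity) (by positivity), Real.log_pow]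
  have h4 : (d : ℝ) * Real.log ((2 * (13 * d ^ 2) + 1 : ℕ) : ℝ) ≤ d * (7 * Real.log n) := by
    gcongr
  linarith

end Numerics

/-! ### The radius -/

lemma exists_radius {d : ℕ} (hd : 1 ≤ d) {c : ℝ} (hc : 0 ≤ c) :
    ∃ r : ℝ → ℝ, (∀ l, 0 ≤ l → 0 ≤ r l) ∧ ∀ l, 0 < l → unitBallVol d * r l ^ d * l = c := by
  have hv := unitBallVol_pos d
  refine ⟨fun l => (c / (unitBallVol d * l)) ^ ((d : ℝ)⁻¹), fun l hl => ?_, fun l hl => ?_⟩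
  · exact Real.rpow_nonneg (div_nonneg hc (by positivity)) _
  · rw [Real.rpow_inv_natCast_pow (by positivity) (by omega)]
    field_simp

/-! ### From representative samples to the theorem -/

section Main

variable {d n k : ℕ} {f : E d → ℝ} {𝒳 A A' : Set (E d)} {σ ε s α r : ℝ}

/-- The sample-size condition bounds `k + s` by the expected number of points in balls. -/
lemma add_le_mul_of_sample_size (hs : s ≤ ε * k / 2)
    (hσ : 0 < σ) (hl : 0 < level f σ A A')
    (hn : (k : ℝ) / (unitBallVol d * (σ / 2) ^ d * level f σ A A') * (1 + ε / 2) ≤ n) :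
    k * (1 + ε / 2) ≤ n * (unitBallVol d * (σ / 2) ^ d * level f σ A A') ∧
      k + s ≤ n * (unitBallVol d * (σ / 2) ^ d * level f σ A A') := by
  have hv := unitBallVol_pos d
  have hV : 0 < unitBallVol d * (σ / 2) ^ d * level f σ A A' := by positivity
  rw [div_mul_eq_mul_div, div_le_iff₀ hV] at hn
  exact ⟨hn, by linarith⟩

lemma mul_level_le_one (hf : IsDensityOn f 𝒳) (hσ : 0 < σ) (hA : A.Nonempty)
    (hl : 0 < level f σ A A') :
    unitBallVol d * (σ / 2) ^ d * level f σ A A' ≤ 1 := by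
  have := hf.isProbabilityMeasure
  obtain ⟨a, ha⟩ := hA
  exact (level_mul_le_of_closedBall hf hl.le (by positivity) ha
    (z := a) (by rw [dist_self]; linarith)).trans measureReal_le_one

/-- Separation and connectedness hold for representative samples. -/
lemma IsRepresentative.separation_and_connectedness {x : Fin n → E d}
    (hx : IsRepresentative f 𝒳 k s x) (hf : IsDensityOn f 𝒳) (hd : 1 ≤ d) (hn0 : 0 < n)
    (hk : 1 ≤ k) (hs0 : 0 ≤ s) (hε : 0 < ε) (hε1 : ε < 1) (hs : s ≤ ε * k / 2) (hα : √2 ≤ α)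
    (hα2 : α ≤ 2) (hA : IsPathConnected A) (hA' : IsPathConnected A') (hσ : 0 < σ)
    (hgap : NoGaps 𝒳 σ) (hsep : Separated f 𝒳 σ ε A A')
    (hn : (k : ℝ) / (unitBallVol d * (σ / 2) ^ d * level f σ A A') * (1 + ε / 2) ≤ n)
    (hr0 : 0 ≤ r) (hr : unitBallVol d * r ^ d * level f σ A A' = (k + s) / n) :
    DisconnectedInGraph x k α r A A' ∧ ConnectedInGraph x k α r A ∧
      ConnectedInGraph x k α r A' := by
  have hl := hsep.level_pos hf hε1
  have hv := unitBallVol_pos d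
  have hk0 : (0 : ℝ) < k := by exact_mod_cast hk
  have hn0' : (0 : ℝ) < n := by exact_mod_cast hn0
  have hpos : 0 < (k + s) / (n : ℝ) := by positivity
  have hrpos : 0 < r := by
    refine lt_of_le_of_ne hr0 fun h => ?_
    rw [← h, zero_pow (by omega), mul_zero, zero_mul] at hr
    exact hpos.ne hr
  have hrσ : r ≤ σ / 2 := by
    have h1 := (add_le_mul_of_sample_size hs hσ hl hn).2
    rw [mul_comm, ← div_le_iff₀ hn0', ← hr] at h1
    have h2 : r ^ d ≤ (σ / 2) ^ d :=
      le_of_mul_le_mul_left (le_of_mul_le_mul_right h1 hl) hv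
    exact le_of_pow_le_pow_left₀ (by omega) (by positivity) h2
  have hquarter : (k : ℝ) / (4 * n) ≤ (k + s) / n / 4 := by
    rw [div_div, mul_comm (n : ℝ) 4]
    gcongr
    linarith
  refine ⟨disconnectedInGraph_of_sample hf hα2 hr0 hrσ hgap hsep hx.mem fun i h => ?_,
    connectedInGraph_of_sample hf hd hα hrpos hrσ hA (A' := A') hl.le (fun i h => ?_)
      (fun i y hy h => ?_),
    connectedInGraph_of_sample hf hd hα hrpos hrσ hA' (A' := A) (by rw [level_comm]; exact hl.le)
      (fun i h => ?_) (fun i y hy h => ?_)⟩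
  -- `(1 - ε)(k + s) ≤ k - s` because `2s ≤ εk`.
  · refine hx.upper i r hr0 (h.trans ?_)
    rw [hr, mul_div_assoc']
    gcongr
    nlinarith
  · exact hx.lower i r hr0 (by rwa [hr] at h)
  · exact hx.half i y r hrpos hy (hquarter.trans (by rwa [hr] at h))
  · exact hx.lower i r hr0 (by rwa [level_comm, hr] at h)
  · exact hx.half i y r hrpos hy (hquarter.trans (by rwa [level_comm, hr] at h))

end Main

end ClusterTree

end

theorem theorem1 :
    ∃ C > (0 : ℝ), ∃ C₀ > (0 : ℝ),
      ∀ (d : ℕ), 1 ≤ d →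
      ∀ (𝒳 : Set (ClusterTree.E d)) (f : ClusterTree.E d → ℝ), ClusterTree.IsDensityOn f 𝒳 →
      ∀ δ ε : ℝ, 0 < δ → δ < 1 → 0 < ε → ε < 1 →
      ∀ (n k : ℕ) (α : ℝ), 1 ≤ k → √2 ≤ α → α ≤ 2 →
        C * (d * Real.log n / ε ^ 2) * Real.log (2 / δ) ^ 2 ≤ (k : ℝ) →
      ∃ r : ℝ → ℝ, (∀ l, 0 ≤ l → 0 ≤ r l) ∧
        (∀ l, 0 < l → ClusterTree.unitBallVol d * r l ^ d * l =
          k / n + C₀ * Real.log (2 / δ) / n * √(k * d * Real.log n)) ∧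
        ∃ G : Set (Fin n → ClusterTree.E d), MeasurableSet G ∧
          ENNReal.ofReal (1 - δ) ≤ ClusterTree.sampleLaw f n G ∧
          ∀ x ∈ G, ∀ (A A' : Set (ClusterTree.E d)) (σ : ℝ),
            A ⊆ 𝒳 → A' ⊆ 𝒳 → IsPathConnected A → IsPathConnected A' →
            0 < σ → ClusterTree.NoGaps 𝒳 σ → ClusterTree.Separated f 𝒳 σ ε A A' →
            (k : ℝ) / (ClusterTree.unitBallVol d * (σ / 2) ^ d * ClusterTree.level f σ A A') *
                (1 + ε / 2) ≤ n →
            ClusterTree.DisconnectedInGraph x k α (r (ClusterTree.level f σ A A')) A A' ∧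
            ClusterTree.ConnectedInGraph x k α (r (ClusterTree.level f σ A A')) A ∧
            ClusterTree.ConnectedInGraph x k α (r (ClusterTree.level f σ A A')) A' := by
  -- With `C₀ = 20`, `s ≤ εk/2` amounts to `4 · 400 log²(2/δ) d log n ≤ ε²k`, hence `C = 1600`.
  refine ⟨1600, by norm_num, 20, by norm_num, ?_⟩
  intro d hd 𝒳 f hf δ ε hδ hδ1 hε hε1 n k α hk hα hα2 hkC
  have hk0 : (1 : ℝ) ≤ k := by exact_mod_cast hk
  have hl := ClusterTree.log_two_le_log_two_div hδ hδ1
  have hlogn : 0 ≤ Real.log n := Real.log_natCast_nonneg n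
  set s : ℝ := 20 * Real.log (2 / δ) * √(k * d * Real.log n) with hs
  have hs0 : 0 ≤ s := by positivity
  have hs2 : s ^ 2 = 400 * Real.log (2 / δ) ^ 2 * (k * (d * Real.log n)) := by
    rw [hs, mul_pow, Real.sq_sqrt (by positivity)]; ring
  have hkε : 1600 * (Real.log (2 / δ) ^ 2 * (d * Real.log n)) ≤ k * ε ^ 2 := by
    have h1 : 1600 * (d * Real.log n / ε ^ 2) * Real.log (2 / δ) ^ 2 =
        1600 * (Real.log (2 / δ) ^ 2 * (d * Real.log n)) / ε ^ 2 := by ring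
    rwa [h1, div_le_iff₀ (by positivity)] at hkC
  have hsε : s ≤ ε * k / 2 := by
    refine le_of_sq_le_sq ?_ (by positivity)
    rw [hs2]
    nlinarith [mul_le_mul_of_nonneg_left hkε (by linarith : (0 : ℝ) ≤ k)]
  have hsk : s ≤ k := by nlinarith
  obtain ⟨r, hr0, hr⟩ := ClusterTree.exists_radius hd (c := (k + s) / n) (by positivity)
  refine ⟨r, hr0, fun l hl => (hr l hl).trans (by rw [hs]; ring), ?_⟩
  -- Otherwise no admissible `A`, `A'`, `σ` exist: a ball has mass at most `1`, so the sample-size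
  -- condition forces `k + s ≤ n` and `n ≥ k(1 + ε/2) > 1`.
  by_cases hmain : 2 ≤ n ∧ k + s ≤ n
  · obtain ⟨hn2, hkn⟩ := hmain
    have hkn' : k ≤ n := by
      have : (k : ℝ) ≤ n := by linarith
      exact_mod_cast this
    have hs2le : 2 ≤ s := by
      refine le_of_sq_le_sq ?_ hs0
      obtain ⟨h1, h2⟩ := ClusterTree.log_two_le_mul_log hd hn2
      have h3 := ClusterTree.add_le_sq_mul hl (h2.trans h1)
      rw [hs2]
      have h4 : 0 ≤ Real.log (2 / δ) ^ 2 * (d * Real.log n) := by positivity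
      nlinarith
    have hk1600 : 1600 * (Real.log (2 / δ) ^ 2 * (d * Real.log n)) ≤ k := by
      refine hkε.trans ?_
      have : ε ^ 2 ≤ 1 := by nlinarith
      nlinarith
    obtain ⟨G, hGm, hG, hGx⟩ := ClusterTree.exists_representative_event hf hd hδ hn2 hs2le hsk hk
      hkn (ClusterTree.tail_bound hd hn2 hk hδ hδ1 hs2)
      (ClusterTree.grid_bound hd hn2 hkn' hδ hδ1 hk1600)
    refine ⟨G, hGm, hG, fun x hx A A' σ _ _ hA hA' hσ hgap hsep hn => ?_⟩
    have hlev := hsep.level_pos hf hε1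
    exact (hGx x hx).separation_and_connectedness hf hd (by omega) hk hs0 hε hε1 hsε hα hα2 hA hA'
      hσ hgap hsep hn (hr0 _ hlev.le) (hr _ hlev)
  · have hprob := hf.isProbabilityMeasure
    have hprob' : IsProbabilityMeasure (ClusterTree.sampleLaw f n) :=
      inferInstanceAs (IsProbabilityMeasure (Measure.pi fun _ => ClusterTree.densityLaw f))
    refine ⟨Set.univ, MeasurableSet.univ, ?_, fun x _ A A' σ _ _ hA _ hσ _ hsep hn => ?_⟩
    · rw [measure_univ]
      exact ENNReal.ofReal_le_one.2 (by linarith)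
    · exfalso
      have hlev := hsep.level_pos hf hε1
      obtain ⟨h1, h2⟩ := ClusterTree.add_le_mul_of_sample_size hsε hσ hlev hn
      have h3 := mul_le_mul_of_nonneg_left
        (ClusterTree.mul_level_le_one hf hσ hA.nonempty hlev) (Nat.cast_nonneg (α := ℝ) n)
      refine hmain ⟨?_, by linarith⟩
      have h4 : (1 : ℝ) < n := by nlinarith
      exact_mod_cast h4
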